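/- Let $\mathbb H=\{z\in\mathbb C:\operatorname{Im}z>0\}$ and $\overline{\mathbb H}=\{z\in\mathbb C:\operatorname{Im}z\ge 0\}$. Let $\alpha\in\mathbb C$ with $\operatorname{Im}\alpha\le 0$, let $U\subset\mathbb C$ be a simply connected domain containing $\overline{\mathbb H}\setminus\{\alpha\}$, and let $f:U\to\mathbb C$ be an injective holomorphic function such that $f(\overline{\mathbb H}\setminus\{\alpha\})$ is convex. Write $f^{-1}:f(U)\to U$ for its inverse. Let $\mu\in\mathbb R$, $\sigma>0$, and let $X_1,X_2,\dots$ be i.i.d. real random variables with the Cauchy distribution $C(\mu,\sigma)$, that is, with density $\frac{\sigma}{\pi}\frac{1}{(x-\mu)^2+\sigma^2}$. (i) Assume that $$E[|f(X_1)|]<\infty,\qquad \lim_{R\to\infty}\frac1R\sup_{\substack{|z|=R\\ z\in\overline{\mathbb H}\setminus\{\alpha\}}}|f(z)|=0,\qquad \lim_{\varepsilon\to0+}\varepsilon\sup_{\substack{|z-\alpha|=\varepsilon\\ z\in\overline{\mathbb H}\setminus\{\alpha\}}}|f(z)|=0$$ (the supremum over the empty set being $0$). Then $$E[f(X_1)]=f(\mu+\sigma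 i),$$ and almost surely $$\lim_{n\to\infty}f^{-1}\Big(\frac1n\sum_{j=1}^n f(X_j)\Big)=\mu+\sigma i.$$ (ii) If, in addition, $E[|f(X_1)|^2]<\infty$, then, identifying $\mathbb C$ with $\mathbb R^2$, as $n\to\infty$, $$\sqrt n\,\Big(f^{-1}\Big(\frac1n\sum_{j=1}^n f(X_j)\Big)-(\mu+\sigma i)\Big)\Rightarrow N\Big(0,\ \frac{\operatorname{Var}(f(X_1))}{2|f'(\mu+\sigma i)|^2}\,I_2\Big)$$ in distribution, where $\operatorname{Var}(Y)=E[|Y-E[Y]|^2]$ for a complex random variable $Y$ and $I_2$ is the $2\times2$ identity matrix. -/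

import Mathlib

open MeasureTheory ProbabilityTheory Filter Topology
open scoped NNReal ENNReal

namespace QAM

/-- The punctured closed upper half-plane `{z : 0 ≤ Im z} \ {α}`. -/
def puncturedHalfPlane (α : ℂ) : Set ℂ := {z : ℂ | 0 ≤ z.im} \ {α}

/-- `f` (used only on `U`) is a generator of a quasi-arithmetic mean: `α` lies in the closed lower
half-plane, `U` is a simply connected domain containing the punctured closed upper half-plane, and
`f` is holomorphic and injective on `U` with convex image of the punctured closed half-plane. -/
structure IsGenerator (α : ℂ) (U : Set ℂ) (f : ℂ → ℂ) : Prop where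
  im_nonpos : α.im ≤ 0
  isOpen : IsOpen U
  isSimplyConnected : IsSimplyConnected U
  subset : puncturedHalfPlane α ⊆ U
  differentiableOn : DifferentiableOn ℂ f U
  injOn : Set.InjOn f U
  convex_image : Convex ℝ (f '' puncturedHalfPlane α)

/-- `R⁻¹ * sup {|f z| : |z| = R, Im z ≥ 0, z ≠ α} → 0` as `R → ∞`. -/
def SublinearAtInfinity (α : ℂ) (f : ℂ → ℂ) : Prop :=
  Tendsto (fun R : ℝ => ENNReal.ofReal (1 / R) *
      ⨆ z ∈ {z : ℂ | z ∈ puncturedHalfPlane α ∧ ‖z‖ = R}, ‖f z‖ₑ) atTop (𝓝 0)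

/-- `ε * sup {|f z| : |z - α| = ε, Im z ≥ 0} → 0` as `ε → 0+`. -/
def MildSingularity (α : ℂ) (f : ℂ → ℂ) : Prop :=
  Tendsto (fun ε : ℝ => ENNReal.ofReal ε *
      ⨆ z ∈ {z : ℂ | z ∈ puncturedHalfPlane α ∧ ‖z - α‖ = ε}, ‖f z‖ₑ) (𝓝[>] 0) (𝓝 0)

/-- The `f`-mean `f⁻¹ ((1/n) ∑_{j<n} f (x_j))`, with `f⁻¹ : f(U) → U`. -/
noncomputable def fMean (U : Set ℂ) (f : ℂ → ℂ) (x : ℕ → ℂ) (n : ℕ) : ℂ :=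
  Function.invFunOn f U ((1 / (n : ℂ)) * ∑ j ∈ Finset.range n, f (x j))

/-- The variance `E[|Y - E[Y]|²]` of a complex random variable. -/
noncomputable def complexVar {Ω : Type*} [MeasurableSpace Ω] (Y : Ω → ℂ) (P : Measure Ω) : ℝ :=
  ∫ ω, ‖Y ω - ∫ ω', Y ω' ∂P‖ ^ 2 ∂P

/-- The identification of `ℂ` with `ℝ²`. -/
noncomputable def toR2 (z : ℂ) : EuclideanSpace ℝ (Fin 2) := !₂[z.re, z.im]

end QAM

/-! The Cauchy law with parameters `μ`, `σ` is harmonic measure of the upper half-plane seen from `γ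
= μ + σ i`. Hence the mean over the real line of a holomorphic function with tame boundary behaviour
is its value at `γ`. This is the mean value property of the disc carried over by a Cayley map
(`integral_cauchyMeasure_eq`).

Since `f` may be unbounded at infinity and singular at `α`, `f` is first multiplied by
`regularizer`, of modulus at most 1. Letting `ε → 0` under dominated convergence yields E[f(X)^p] =
f(γ)^p whenever f(X)^p is integrable (`IsGenerator.integral_pow_cauchyMeasure`).

The case p = 1 identifies the mean. The strong law and continuity of the inverse of `f` at `f γ`
then give almost sure convergence. The case p = 2 gives E[(f(X) - f(γ))²] = 0: real and imaginary
parts are uncorrelated with equal variance. This isotropy makes the limiting covariance a multiple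
of the identity. Finally `f' γ ≠ 0`, so the inverse is differentiable at `f γ`, and the delta method
multiplies by the complex number `1 / f' γ`, a similarity that preserves isotropy. -/

namespace QAM

/-! ### Injective holomorphic functions and their inverses. -/

section Univalent

variable {U : Set ℂ} {f : ℂ → ℂ} {z : ℂ}

/-- An injective holomorphic function is a local open map. -/
lemma nhds_le_map_nhds_of_injOn (hU : IsOpen U) (hd : DifferentiableOn ℂ f U)
    (hi : Set.InjOn f U) (hz : z ∈ U) : 𝓝 (f z) ≤ map f (𝓝 z) := by
  refine ((hd.analyticAt (hU.mem_nhds hz)).eventually_constant_or_nhds_le_map_nhds).resolve_left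
    fun h => ?_
  have h' : ∀ᶠ w in 𝓝[≠] z, w ∈ U ∧ f w = f z :=
    ((hU.eventually_mem hz).and h).filter_mono nhdsWithin_le_nhds
  obtain ⟨w, ⟨hwU, hw⟩, hne⟩ := (h'.and self_mem_nhdsWithin).exists
  exact hne (hi hwU hz hw)

lemma isOpen_image_of_injOn (hU : IsOpen U) (hd : DifferentiableOn ℂ f U)
    (hi : Set.InjOn f U) : IsOpen (f '' U) := by
  rw [isOpen_iff_mem_nhds]
  rintro _ ⟨z, hz, rfl⟩
  exact nhds_le_map_nhds_of_injOn hU hd hi hz (image_mem_map (hU.mem_nhds hz))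

lemma invFunOn_apply_of_injOn (hi : Set.InjOn f U) (hz : z ∈ U) :
    Function.invFunOn f U (f z) = z :=
  hi.leftInvOn_invFunOn hz

lemma continuousAt_invFunOn (hU : IsOpen U) (hd : DifferentiableOn ℂ f U)
    (hi : Set.InjOn f U) (hz : z ∈ U) : ContinuousAt (Function.invFunOn f U) (f z) := by
  have h : Tendsto (Function.invFunOn f U) (map f (𝓝 z)) (𝓝 z) := by
    rw [tendsto_map'_iff]
    refine tendsto_id.congr' ?_
    filter_upwards [hU.mem_nhds hz] with w hw
    exact (invFunOn_apply_of_injOn hi hw).symm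
  rw [ContinuousAt, invFunOn_apply_of_injOn hi hz]
  exact h.mono_left (nhds_le_map_nhds_of_injOn hU hd hi hz)

lemma eventually_apply_invFunOn (hU : IsOpen U) (hd : DifferentiableOn ℂ f U)
    (hi : Set.InjOn f U) (hz : z ∈ U) : ∀ᶠ w in 𝓝 (f z), f (Function.invFunOn f U w) = w := by
  filter_upwards [(isOpen_image_of_injOn hU hd hi).mem_nhds (Set.mem_image_of_mem f hz)] with w hw
  exact Function.invFunOn_eq hw

/-- The derivative of an injective holomorphic function has no zeros. -/
lemma deriv_ne_zero_of_injOn (hU : IsOpen U) (hd : DifferentiableOn ℂ f U)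
    (hi : Set.InjOn f U) (hz : z ∈ U) : deriv f z ≠ 0 := by
  -- The inverse `g` is continuous at `f z` and differentiable at nearby points, where `f'` does not
  -- vanish. The singularity at `f z` is therefore removable, and the chain rule for `g ∘ f = id`
  -- excludes `f' z = 0`.
  set g := Function.invFunOn f U
  have hgz : g (f z) = z := invFunOn_apply_of_injOn hi hz
  have hgc : ContinuousAt g (f z) := continuousAt_invFunOn hU hd hi hz
  have hfd : ∀ w ∈ U, HasDerivAt f (deriv f w) w := fun w hw =>
    (hd.differentiableAt (hU.mem_nhds hw)).hasDerivAt
  -- Otherwise `f'` vanishes on a ball, where `f` is then constant, against injectivity.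
  have hisol : ∀ᶠ w in 𝓝[≠] z, deriv f w ≠ 0 := by
    refine ((hd.analyticAt (hU.mem_nhds hz)).deriv.eventually_eq_zero_or_eventually_ne_zero
      ).resolve_left fun h => ?_
    obtain ⟨r, hr, hball⟩ := Metric.eventually_nhds_iff_ball.1 (h.and (hU.eventually_mem hz))
    have hconst : ∀ w ∈ Metric.ball z r, f w = f z := fun w hw =>
      (convex_ball z r).is_const_of_fderivWithin_eq_zero (𝕜 := ℂ)
        (fun x hx => (hd x (hball x hx).2).mono fun y hy => (hball y hy).2)
        (fun x hx => by
          rw [fderivWithin_of_isOpen Metric.isOpen_ball hx]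
          ext
          simpa using (hball x hx).1) hw (Metric.mem_ball_self hr)
    have h' : ∀ᶠ w in 𝓝[≠] z, w ∈ Metric.ball z r :=
      mem_nhdsWithin_of_mem_nhds (Metric.ball_mem_nhds z hr)
    obtain ⟨w, hw, hne⟩ := (h'.and self_mem_nhdsWithin).exists
    exact hne (hi (hball w hw).2 hz (hconst w hw))
  have hgt : Tendsto g (𝓝[≠] (f z)) (𝓝[≠] z) := by
    refine tendsto_nhdsWithin_iff.2 ⟨?_, ?_⟩
    · have := hgc.tendsto
      rw [hgz] at this
      exact this.mono_left nhdsWithin_le_nhds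
    · filter_upwards [(eventually_apply_invFunOn hU hd hi hz).filter_mono nhdsWithin_le_nhds,
        self_mem_nhdsWithin] with w hw hne h
      exact hne (hw.symm.trans (congrArg f h))
  have hgd : ∀ᶠ w in 𝓝[≠] (f z), DifferentiableAt ℂ g w := by
    filter_upwards [hgt.eventually hisol, mem_nhdsWithin_of_mem_nhds
      ((isOpen_image_of_injOn hU hd hi).mem_nhds (Set.mem_image_of_mem f hz))]
    rintro _ hw ⟨v, hv, rfl⟩
    have hgv : g (f v) = v := invFunOn_apply_of_injOn hi hv
    rw [hgv] at hw
    exact (HasDerivAt.of_local_left_inverse (continuousAt_invFunOn hU hd hi hv)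
      (by rw [invFunOn_apply_of_injOn hi hv]; exact hfd v hv) hw
      (eventually_apply_invFunOn hU hd hi hv)).differentiableAt
  have hgdz : DifferentiableAt ℂ g (f z) :=
    (Complex.analyticAt_of_differentiable_on_punctured_nhds_of_continuousAt hgd hgc
      ).differentiableAt
  have hcomp : HasDerivAt (g ∘ f) (deriv g (f z) * deriv f z) z :=
    hgdz.hasDerivAt.comp z (hfd z hz)
  have hid : HasDerivAt (g ∘ f) 1 z := by
    refine (hasDerivAt_id z).congr_of_eventuallyEq ?_
    filter_upwards [hU.mem_nhds hz] with w hw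
    exact invFunOn_apply_of_injOn hi hw
  intro h0
  have := hcomp.unique hid
  simp [h0] at this

lemma hasDerivAt_invFunOn (hU : IsOpen U) (hd : DifferentiableOn ℂ f U)
    (hi : Set.InjOn f U) (hz : z ∈ U) :
    HasDerivAt (Function.invFunOn f U) (deriv f z)⁻¹ (f z) :=
  HasDerivAt.of_local_left_inverse (continuousAt_invFunOn hU hd hi hz)
    (by
      rw [invFunOn_apply_of_injOn hi hz]
      exact (hd.differentiableAt (hU.mem_nhds hz)).hasDerivAt)
    (deriv_ne_zero_of_injOn hU hd hi hz) (eventually_apply_invFunOn hU hd hi hz)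

/-- The inverse is continuous on the open image and takes a single default value off it. The delta
method needs measurability on all of `ℂ`. -/
lemma measurable_invFunOn (hU : IsOpen U) (hd : DifferentiableOn ℂ f U)
    (hi : Set.InjOn f U) : Measurable (Function.invFunOn f U) := by
  refine measurable_of_restrict_of_restrict_compl (s := f '' U)
    (isOpen_image_of_injOn hU hd hi).measurableSet ?_ ?_
  · refine Continuous.measurable (continuousOn_iff_continuous_domRestrict.1 ?_)
    rintro _ ⟨z, hz, rfl⟩
    exact (continuousAt_invFunOn hU hd hi hz).continuousWithinAt
  · have : (f '' U)ᶜ.domRestrict (Function.invFunOn f U) =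
        fun _ => Classical.choice (inferInstance : Nonempty ℂ) := by
      ext w
      exact Function.invFunOn_neg w.2
    rw [this]
    exact measurable_const

end Univalent

/-! ### The Poisson formula for the Cauchy distribution. -/

section Poisson

variable {μ σ : ℝ} {w : ℂ}

/-- The Cayley-type map of the unit disc onto the upper half-plane sending `0` to `μ + σ i` and
`-1` to infinity. -/
noncomputable def cayley (μ σ : ℝ) (w : ℂ) : ℂ :=
  (μ - σ * Complex.I) + 2 * σ * Complex.I * (1 + w)⁻¹

lemma cayley_zero : cayley μ σ 0 = μ + σ * Complex.I := by
  simp only [cayley, add_zero, inv_one]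
  ring

lemma im_cayley (hw : w ≠ -1) :
    (cayley μ σ w).im = σ * (1 - Complex.normSq w) / Complex.normSq (1 + w) := by
  have h : Complex.normSq (1 + w) ≠ 0 := by
    rw [Ne, Complex.normSq_eq_zero]
    exact fun h => hw (eq_neg_of_add_eq_zero_right h)
  have : (cayley μ σ w).im = -σ + 2 * σ * ((1 + w.re) / Complex.normSq (1 + w)) := by
    simp [cayley, Complex.inv_re, Complex.inv_im]
  rw [this]
  field_simp
  simp only [Complex.normSq_apply, Complex.add_re, Complex.add_im, Complex.one_re, Complex.one_im]
  ring

lemma im_cayley_pos (hσ : 0 < σ) (hw : ‖w‖ < 1) : 0 < (cayley μ σ w).im := by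
  have h1 : w ≠ -1 := by
    rintro rfl
    simp at hw
  have h2 : 0 < Complex.normSq (1 + w) := by
    rw [Complex.normSq_pos]
    exact fun h => h1 (eq_neg_of_add_eq_zero_right h)
  rw [im_cayley h1]
  have : Complex.normSq w < 1 := by
    rw [Complex.normSq_eq_norm_sq]
    nlinarith [norm_nonneg w]
  have : 0 < 1 - Complex.normSq w := by linarith
  positivity

lemma im_cayley_nonneg (hσ : 0 < σ) (h1 : w ≠ -1) (hw : ‖w‖ ≤ 1) : 0 ≤ (cayley μ σ w).im := by
  rw [im_cayley h1]
  have : Complex.normSq w ≤ 1 := by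
    rw [Complex.normSq_eq_norm_sq]
    nlinarith [norm_nonneg w]
  have : 0 ≤ 1 - Complex.normSq w := by linarith
  have := Complex.normSq_nonneg (1 + w)
  positivity

lemma differentiableAt_cayley (hw : w ≠ -1) : DifferentiableAt ℂ (cayley μ σ) w := by
  have h : 1 + w ≠ 0 := fun h => hw (eq_neg_of_add_eq_zero_right h)
  unfold cayley
  fun_prop (disch := assumption)

lemma tendsto_cayley_cobounded (hσ : 0 < σ) :
    Tendsto (cayley μ σ) (𝓝[≠] (-1)) (Bornology.cobounded ℂ) := by
  have h1 : Tendsto (fun w : ℂ => 1 + w) (𝓝[≠] (-1)) (𝓝[≠] 0) := by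
    refine tendsto_nhdsWithin_iff.2 ⟨?_, ?_⟩
    · have : ContinuousAt (fun w : ℂ => 1 + w) (-1) := by fun_prop
      have := this.tendsto
      simp only [add_neg_cancel] at this
      exact this.mono_left nhdsWithin_le_nhds
    · filter_upwards [self_mem_nhdsWithin] with w hw h
      exact hw (eq_neg_of_add_eq_zero_right h)
  have h2 : Tendsto (fun w : ℂ => ‖(1 + w)⁻¹‖) (𝓝[≠] (-1)) atTop :=
    tendsto_norm_cobounded_atTop.comp (tendsto_inv₀_nhdsNE_zero.comp h1)
  rw [← tendsto_norm_atTop_iff_cobounded]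
  have h3 := tendsto_atTop_add_const_left _ (-‖(μ - σ * Complex.I : ℂ)‖)
    (h2.const_mul_atTop (show 0 < 2 * σ by positivity))
  refine tendsto_atTop_mono (fun w => ?_) h3
  have h4 : ‖2 * σ * Complex.I * (1 + w)⁻¹‖ = 2 * σ * ‖(1 + w)⁻¹‖ := by
    simp [abs_of_pos hσ]
  rw [← h4, cayley, add_comm (μ - σ * Complex.I : ℂ)]
  have := norm_sub_norm_le (2 * σ * Complex.I * (1 + w)⁻¹) (-(μ - σ * Complex.I : ℂ))
  rw [sub_neg_eq_add, norm_neg] at this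
  linarith

/-- Half-angle substitution: the point is the square of exp(i arctan t) = cos(arctan t) (1 + t i).
-/
lemma circleMap_two_mul_arctan (t : ℝ) :
    circleMap 0 1 (2 * Real.arctan t) = (1 + t * Complex.I) ^ 2 / (1 + t ^ 2) := by
  have hc : (Real.cos (Real.arctan t)) ^ 2 = 1 / (1 + t ^ 2) := Real.cos_sq_arctan t
  have hs : Real.sin (Real.arctan t) = t * Real.cos (Real.arctan t) := by
    rw [Real.sin_arctan, Real.cos_arctan]
    ring
  have : circleMap 0 1 (2 * Real.arctan t) =
      ((Real.cos (Real.arctan t) : ℂ) + Real.sin (Real.arctan t) * Complex.I) ^ 2 := by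
    rw [circleMap_zero, Complex.ofReal_cos, Complex.ofReal_sin, ← Complex.exp_mul_I,
      ← Complex.exp_nat_mul]
    push_cast
    rw [one_mul]
    ring_nf
  rw [this, hs]
  have hc' : (Real.cos (Real.arctan t) : ℂ) ^ 2 = 1 / (1 + t ^ 2) := by exact_mod_cast hc
  calc ((Real.cos (Real.arctan t) : ℂ) + (t * Real.cos (Real.arctan t) : ℝ) * Complex.I) ^ 2
      = (Real.cos (Real.arctan t) : ℂ) ^ 2 * (1 + t * Complex.I) ^ 2 := by
        push_cast
        ring
    _ = _ := by rw [hc']; ring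

lemma one_add_sq_ne_zero (t : ℝ) : (1 + t ^ 2 : ℂ) ≠ 0 := by
  have : (1 + t ^ 2 : ℝ) ≠ 0 := by positivity
  exact_mod_cast this

lemma one_sub_mul_I_ne_zero (t : ℝ) : (1 - t * Complex.I : ℂ) ≠ 0 := fun h => by
  simpa using congrArg Complex.re h

lemma one_add_circleMap_two_mul_arctan (t : ℝ) :
    1 + circleMap 0 1 (2 * Real.arctan t) = 2 * (1 - t * Complex.I)⁻¹ := by
  rw [circleMap_two_mul_arctan]
  have h1 := one_add_sq_ne_zero t
  have h2 := one_sub_mul_I_ne_zero t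
  field_simp
  ring_nf
  simp only [Complex.I_sq, show Complex.I ^ 3 = -Complex.I from Complex.I_pow_three]
  ring

lemma circleMap_two_mul_arctan_ne (t : ℝ) : circleMap 0 1 (2 * Real.arctan t) ≠ -1 := fun h => by
  have := one_add_circleMap_two_mul_arctan t
  rw [h, add_neg_cancel] at this
  simp [one_sub_mul_I_ne_zero t] at this

/-- For `t = (x - μ) / σ` the image is `x`, so the angle `2 arctan ((x - μ) / σ)` parametrizes the
circle minus `-1` by the real line compatibly with `cayley`. -/
lemma cayley_circleMap (t : ℝ) :
    cayley μ σ (circleMap 0 1 (2 * Real.arctan t)) = ((μ + σ * t : ℝ) : ℂ) := by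
  rw [cayley, one_add_circleMap_two_mul_arctan, mul_inv, inv_inv]
  push_cast
  linear_combination (-σ * t : ℂ) * Complex.I_sq

/-- The circle average as an average against the Cauchy distribution. -/
lemma circleAverage_eq_integral_cauchyMeasure (μ : ℝ) {σ : ℝ≥0} (hσ : 0 < σ) (H : ℂ → ℂ) :
    Real.circleAverage H 0 1 =
      ∫ x, H (circleMap 0 1 (2 * Real.arctan ((x - μ) / σ))) ∂(cauchyMeasure μ σ) := by
  have hσ' : (0 : ℝ) < σ := hσ
  set φ : ℝ → ℝ := fun x => 2 * Real.arctan ((x - μ) / σ) with hφ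
  -- The Jacobian of the angle is `2π` times the Cauchy density; the `2π` cancels against the
  -- normalization of the circle average.
  have hderiv : ∀ x, HasDerivAt φ (2 * Real.pi * cauchyPDFReal μ σ x) x := by
    intro x
    have h := (((hasDerivAt_id x).sub_const μ).div_const (σ : ℝ)).arctan.const_mul 2
    refine h.congr_deriv ?_
    rw [cauchyPDFReal_def]
    have := Real.pi_pos
    simp only [id]
    field_simp
    ring
  have hinj : Function.Injective φ := by
    intro x y hxy
    have := Real.arctan_injective (mul_left_cancel₀ two_ne_zero hxy)
    field_simp at this
    linarith
  have hrange : φ '' Set.univ = Set.Ioo (-Real.pi) Real.pi := by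
    ext θ
    constructor
    · rintro ⟨x, -, rfl⟩
      have := Real.arctan_mem_Ioo ((x - μ) / σ)
      constructor <;> simp only [hφ] <;> linarith [this.1, this.2]
    · intro hθ
      obtain ⟨t, ht⟩ : θ / 2 ∈ Set.range Real.arctan := by
        rw [Real.range_arctan]
        constructor <;> linarith [hθ.1, hθ.2]
      refine ⟨μ + σ * t, trivial, ?_⟩
      simp only [hφ]
      rw [add_sub_cancel_left, mul_div_cancel_left₀ _ hσ'.ne', ht]
      ring
  -- Periodicity moves the interval from `(0, 2π)` to `(-π, π)`, the range of `2 arctan`.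
  have h1 : Real.circleAverage H 0 1 =
      (2 * Real.pi)⁻¹ • ∫ θ in Set.Ioo (-Real.pi) Real.pi, H (circleMap 0 1 θ) := by
    rw [Real.circleAverage_def, ← integral_Ioc_eq_integral_Ioo,
      ← intervalIntegral.integral_of_le (by linarith [Real.pi_pos])]
    have hper : (fun θ => H (circleMap 0 1 θ)).Periodic (2 * Real.pi) :=
      fun x => by simp [periodic_circleMap 0 1 x]
    have := hper.intervalIntegral_add_eq 0 (-Real.pi)
    rw [zero_add, show -Real.pi + 2 * Real.pi = Real.pi by ring] at this
    rw [this]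
  rw [h1, ← hrange, integral_image_eq_integral_abs_deriv_smul MeasurableSet.univ
    (fun x _ => (hderiv x).hasDerivWithinAt) hinj.injOn, Measure.restrict_univ,
    cauchyMeasure_of_scale_ne_zero μ hσ.ne',
    integral_withDensity_eq_integral_toReal_smul (measurable_cauchyPDF μ σ)
      (ae_of_all _ fun x => by simp [cauchyPDF_def]), ← integral_smul]
  congr 1
  ext x
  have hp := cauchyPDF_pos μ hσ.ne' x
  have hpi := Real.pi_pos
  rw [abs_of_pos (by positivity), cauchyPDF_def, ENNReal.toReal_ofReal hp.le, smul_smul,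
    ← mul_assoc, inv_mul_cancel₀ (by positivity), one_mul]

/-- The **Poisson integral formula** in the upper half-plane. -/
theorem integral_cauchyMeasure_eq (μ : ℝ) {σ : ℝ≥0} (hσ : 0 < σ) {h : ℂ → ℂ}
    (hcont : ContinuousOn h {z | 0 ≤ z.im}) (hdiff : DifferentiableOn ℂ h {z | 0 < z.im})
    (hinf : Tendsto h (Bornology.cobounded ℂ ⊓ 𝓟 {z | 0 ≤ z.im}) (𝓝 0)) :
    ∫ x : ℝ, h x ∂(cauchyMeasure μ σ) = h (μ + σ * Complex.I) := by
  have hσ' : (0 : ℝ) < σ := hσ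
  -- The point `-1` corresponds to infinity, where `h` tends to 0; the value 0 there makes `H`
  -- continuous on the closed disc.
  set H : ℂ → ℂ := Function.update (h ∘ cayley μ σ) (-1) 0 with hH
  have hHne : ∀ w, w ≠ -1 → H w = h (cayley μ σ w) := fun w hw => by
    simp [hH, Function.update_of_ne hw]
  have hHev : ∀ w, w ≠ -1 → H =ᶠ[𝓝 w] h ∘ cayley μ σ := fun w hw => by
    filter_upwards [isOpen_ne.mem_nhds hw] with v hv using hHne v hv
  have hHc : ContinuousOn H (Metric.closedBall 0 |1|) := by
    rw [abs_one]
    intro w hw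
    rcases eq_or_ne w (-1) with rfl | hne
    · rw [hH, continuousWithinAt_update_same]
      refine hinf.comp (tendsto_inf.2 ⟨(tendsto_cayley_cobounded hσ').mono_left
        (nhdsWithin_mono _ fun v hv => hv.2), tendsto_principal.2 ?_⟩)
      filter_upwards [self_mem_nhdsWithin] with v hv
      exact im_cayley_nonneg hσ' hv.2 (by simpa using hv.1)
    · refine ContinuousWithinAt.congr_of_eventuallyEq (f := h ∘ cayley μ σ) ?_
        ((hHev w hne).filter_mono nhdsWithin_le_nhds) (hHne w hne)
      have hsub : Tendsto (cayley μ σ) (𝓝[Metric.closedBall 0 1] w)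
          (𝓝[{z | 0 ≤ z.im}] (cayley μ σ w)) := by
        refine tendsto_nhdsWithin_iff.2 ⟨(differentiableAt_cayley hne).continuousAt.tendsto.mono_left
          nhdsWithin_le_nhds, ?_⟩
        filter_upwards [self_mem_nhdsWithin, mem_nhdsWithin_of_mem_nhds (isOpen_ne.mem_nhds hne)]
          with v hv hv'
        exact im_cayley_nonneg hσ' hv' (by simpa using hv)
      exact (hcont _ (im_cayley_nonneg hσ' hne (by simpa using hw))).tendsto.comp hsub
  have hHd : ∀ w ∈ Metric.ball (0 : ℂ) |1| \ ∅, DifferentiableAt ℂ H w := by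
    intro w hw
    have hw1 : ‖w‖ < 1 := by simpa using hw
    have hne : w ≠ -1 := by
      rintro rfl
      simp at hw1
    refine DifferentiableAt.congr_of_eventuallyEq ?_ (hHev w hne)
    refine (hdiff.differentiableAt ?_).comp w (differentiableAt_cayley hne)
    exact (isOpen_lt continuous_const Complex.continuous_im).mem_nhds (im_cayley_pos hσ' hw1)
  have hmean := circleAverage_of_differentiable_on_off_countable Set.countable_empty hHc hHd
  rw [hHne 0 (by simp), cayley_zero, circleAverage_eq_integral_cauchyMeasure μ hσ] at hmean
  refine Eq.trans ?_ hmean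
  congr 1
  ext x
  rw [hHne _ (circleMap_two_mul_arctan_ne _), cayley_circleMap, mul_div_cancel₀ _ hσ'.ne',
    add_sub_cancel]

end Poisson

/-! ### Removing the singularities at `α` and at infinity. -/

section Regularization

variable {α z u : ℂ} {U : Set ℂ} {f : ℂ → ℂ} {ε : ℝ}

lemma norm_le_norm_add_mul_I (hε : 0 ≤ ε) (hu : 0 ≤ u.im) : ‖u‖ ≤ ‖u + ε * Complex.I‖ := by
  rw [Complex.norm_def, Complex.norm_def]
  refine Real.sqrt_le_sqrt ?_
  simp only [Complex.normSq_apply, Complex.add_re, Complex.add_im, Complex.mul_re, Complex.mul_im,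
    Complex.ofReal_re, Complex.ofReal_im, Complex.I_re, Complex.I_im]
  nlinarith [mul_nonneg hε hu, mul_nonneg hε hε]

lemma one_le_norm_one_sub (hε : 0 ≤ ε) (hz : 0 ≤ z.im) : 1 ≤ ‖1 - ε * Complex.I * z‖ := by
  refine le_trans ?_ (Complex.re_le_norm _)
  simp
  positivity

/-- Up to a factor of modulus `ε`, the right side is the norm of `z + i/ε`, and moving a point of
the upper half-plane upwards does not shorten it. -/
lemma mul_norm_le_norm_one_sub (hε : 0 < ε) (hz : 0 ≤ z.im) :
    ε * ‖z‖ ≤ ‖1 - ε * Complex.I * z‖ := by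
  have hε' : (ε : ℂ) ≠ 0 := by exact_mod_cast hε.ne'
  have h : 1 - ε * Complex.I * z = -(ε * Complex.I) * (z + (ε⁻¹ : ℝ) * Complex.I) := by
    push_cast
    field_simp
    linear_combination Complex.I_sq
  rw [h, norm_mul]
  have : ‖-(ε * Complex.I : ℂ)‖ = ε := by simp [abs_of_pos hε]
  rw [this]
  exact mul_le_mul_of_nonneg_left (norm_le_norm_add_mul_I (by positivity) hz) hε.le

/-- A bounded multiplier on the upper half-plane that vanishes at `α` and decays at infinity, and
tends to `1` as `ε` tends to `0`. -/
noncomputable def regularizer (α : ℂ) (ε : ℝ) (z : ℂ) : ℂ :=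
  (z - α) / ((z - α + ε * Complex.I) * (1 - ε * Complex.I * z))

lemma regularizer_self : regularizer α ε α = 0 := by simp [regularizer]

/-- The poles of the regularizer, `α - ε i` and `-i/ε`, lie strictly below the real axis; this and
`one_sub_ne_zero` exclude them in turn. -/
lemma sub_add_ne_zero (hα : α.im ≤ 0) (hε : 0 < ε) (hz : 0 ≤ z.im) :
    z - α + ε * Complex.I ≠ 0 := fun h => by
  have := congrArg Complex.im h
  simp at this
  linarith

lemma one_sub_ne_zero (hε : 0 < ε) (hz : 0 ≤ z.im) : 1 - ε * Complex.I * z ≠ 0 := fun h => by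
  have := one_le_norm_one_sub hε.le hz
  rw [h, norm_zero] at this
  linarith

lemma differentiableAt_regularizer (hα : α.im ≤ 0) (hε : 0 < ε) (hz : 0 ≤ z.im) :
    DifferentiableAt ℂ (regularizer α ε) z := by
  have h := mul_ne_zero (sub_add_ne_zero hα hε hz) (one_sub_ne_zero hε hz)
  unfold regularizer
  fun_prop (disch := assumption)

lemma norm_div_sub_add_le_one (hα : α.im ≤ 0) (hε : 0 < ε) (hz : 0 ≤ z.im) :
    ‖z - α‖ / ‖z - α + ε * Complex.I‖ ≤ 1 :=
  div_le_one_of_le₀ (norm_le_norm_add_mul_I hε.le (by simp; linarith)) (norm_nonneg _)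

lemma norm_regularizer_le_one (hα : α.im ≤ 0) (hε : 0 < ε) (hz : 0 ≤ z.im) :
    ‖regularizer α ε z‖ ≤ 1 := by
  rw [regularizer, norm_div, norm_mul, ← div_div]
  exact div_le_one_of_le₀ ((norm_div_sub_add_le_one hα hε hz).trans (one_le_norm_one_sub hε.le hz))
    (norm_nonneg _)

/-- Decay of order `1/|z|` is what beats the growth `o(|z|)` of `f`. -/
lemma norm_regularizer_le_inv (hα : α.im ≤ 0) (hε : 0 < ε) (hz : 0 ≤ z.im) (hz0 : z ≠ 0) :
    ‖regularizer α ε z‖ ≤ ε⁻¹ * ‖z‖⁻¹ := by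
  have hz0' : 0 < ‖z‖ := norm_pos_iff.2 hz0
  rw [regularizer, norm_div, norm_mul, ← div_div, ← mul_inv, ← one_div (ε * ‖z‖)]
  exact div_le_div₀ zero_le_one (norm_div_sub_add_le_one hα hε hz) (by positivity)
    (mul_norm_le_norm_one_sub hε hz)

/-- The simple zero at `α` beats the growth `o(1/|z - α|)` of `f`. -/
lemma norm_regularizer_le_norm_sub (hα : α.im ≤ 0) (hε : 0 < ε) (hz : 0 ≤ z.im) :
    ‖regularizer α ε z‖ ≤ ε⁻¹ * ‖z - α‖ := by
  have h1 : ε ≤ ‖z - α + ε * Complex.I‖ := by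
    refine le_trans ?_ (Complex.im_le_norm _)
    simp
    linarith
  have h2 : ε * 1 ≤ ‖z - α + ε * Complex.I‖ * ‖1 - ε * Complex.I * z‖ :=
    mul_le_mul h1 (one_le_norm_one_sub hε.le hz) zero_le_one (norm_nonneg _)
  rw [regularizer, norm_div, norm_mul, inv_mul_eq_div]
  exact div_le_div_of_nonneg_left (norm_nonneg _) hε (by linarith)

lemma tendsto_regularizer (hz : z ≠ α) :
    Tendsto (fun ε : ℝ => regularizer α ε z) (𝓝[>] 0) (𝓝 1) := by
  have hne : z - α ≠ 0 := sub_ne_zero.2 hz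
  have : ContinuousAt (fun ε : ℝ => regularizer α ε z) 0 := by
    unfold regularizer
    refine ContinuousAt.div (by fun_prop) (by fun_prop) ?_
    simpa using hne
  have h0 : regularizer α (0 : ℝ) z = 1 := by
    simp [regularizer, hne]
  have h := this.tendsto
  rw [h0] at h
  exact h.mono_left nhdsWithin_le_nhds

/-- Under the growth condition at infinity, `f z / z` tends to `0` in the upper half-plane. -/
lemma SublinearAtInfinity.tendsto (h : SublinearAtInfinity α f) :
    Tendsto (fun z => ‖z‖⁻¹ * ‖f z‖) (Bornology.cobounded ℂ ⊓ 𝓟 {z | 0 ≤ z.im}) (𝓝 0) := by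
  have h1 := Tendsto.comp h (tendsto_norm_cobounded_atTop (E := ℂ))
  have h2 : Tendsto (fun z : ℂ => ENNReal.ofReal (‖z‖⁻¹ * ‖f z‖))
      (Bornology.cobounded ℂ ⊓ 𝓟 {z | 0 ≤ z.im}) (𝓝 0) := by
    refine tendsto_of_tendsto_of_tendsto_of_le_of_le' tendsto_const_nhds (h1.mono_left inf_le_left)
      (Eventually.of_forall fun _ => zero_le) ?_
    have hne : ∀ᶠ z in Bornology.cobounded ℂ, z ≠ α :=
      (tendsto_norm_cobounded_atTop.eventually_gt_atTop ‖α‖).mono fun z hz h => by simp [h] at hz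
    filter_upwards [hne.filter_mono inf_le_left, (eventually_principal.2 fun z hz => hz :
      ∀ᶠ z in 𝓟 {z : ℂ | 0 ≤ z.im}, z ∈ {z : ℂ | 0 ≤ z.im}).filter_mono inf_le_right] with z hz hz'
    rw [ENNReal.ofReal_mul (by positivity), ofReal_norm, Function.comp, one_div]
    gcongr
    exact le_iSup₂_of_le z ⟨⟨hz', hz⟩, rfl⟩ le_rfl
  have h3 := (ENNReal.tendsto_toReal ENNReal.zero_ne_top).comp h2
  refine h3.congr fun z => ?_
  exact ENNReal.toReal_ofReal (by positivity)

/-- Under the growth condition at `α`, `(z - α) f z` tends to `0` at `α` in the upper half-plane. -/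
lemma MildSingularity.tendsto (h : MildSingularity α f) :
    Tendsto (fun z => ‖z - α‖ * ‖f z‖) (𝓝[puncturedHalfPlane α] α) (𝓝 0) := by
  have h0 : Tendsto (fun z => ‖z - α‖) (𝓝[puncturedHalfPlane α] α) (𝓝[>] 0) := by
    refine tendsto_nhdsWithin_iff.2 ⟨?_, ?_⟩
    · have : ContinuousAt (fun z => ‖z - α‖) α := by fun_prop
      have := this.tendsto
      simp only [sub_self, norm_zero] at this
      exact this.mono_left nhdsWithin_le_nhds
    · filter_upwards [self_mem_nhdsWithin] with z hz
      exact norm_pos_iff.2 (sub_ne_zero.2 hz.2)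
  have h2 : Tendsto (fun z : ℂ => ENNReal.ofReal (‖z - α‖ * ‖f z‖))
      (𝓝[puncturedHalfPlane α] α) (𝓝 0) := by
    refine tendsto_of_tendsto_of_tendsto_of_le_of_le' tendsto_const_nhds (Tendsto.comp h h0)
      (Eventually.of_forall fun _ => zero_le) ?_
    filter_upwards [self_mem_nhdsWithin] with z hz
    rw [ENNReal.ofReal_mul (by positivity), ofReal_norm (f z)]
    change _ ≤ ENNReal.ofReal ‖z - α‖ *
      ⨆ w ∈ {w : ℂ | w ∈ puncturedHalfPlane α ∧ ‖w - α‖ = ‖z - α‖}, ‖f w‖ₑ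
    gcongr
    exact le_biSup (fun w => ‖f w‖ₑ)
      (show z ∈ {w : ℂ | w ∈ puncturedHalfPlane α ∧ ‖w - α‖ = ‖z - α‖} from ⟨hz, rfl⟩)
  have h3 := (ENNReal.tendsto_toReal ENNReal.zero_ne_top).comp h2
  refine h3.congr fun z => ?_
  exact ENNReal.toReal_ofReal (by positivity)

lemma IsGenerator.mem (hf : IsGenerator α U f) (hz : 0 < z.im) : z ∈ U :=
  hf.subset ⟨hz.le, fun h => by
    have := hf.im_nonpos
    rw [Set.mem_singleton_iff.1 h] at hz
    linarith⟩

lemma IsGenerator.continuousOn_mul_regularizer (hf : IsGenerator α U f)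
    (hsing : MildSingularity α f) (hε : 0 < ε) :
    ContinuousOn (fun z => f z * regularizer α ε z) {z | 0 ≤ z.im} := by
  intro z hz
  rcases eq_or_ne z α with rfl | hne
  -- The product is 0 at this point whatever value `f` has there, so continuity reduces to a limit
  -- along the punctured half-plane.
  · have : (fun w => f w * regularizer z ε w) =
        Function.update (fun w => f w * regularizer z ε w) z 0 := by
      rw [eq_comm, Function.update_eq_self_iff, regularizer_self, mul_zero]
    rw [this, continuousWithinAt_update_same]
    have hb := hsing.tendsto.const_mul ε⁻¹
    rw [mul_zero] at hb
    refine squeeze_zero_norm' ?_ hb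
    filter_upwards [self_mem_nhdsWithin] with w hw
    rw [norm_mul]
    calc ‖f w‖ * ‖regularizer z ε w‖ ≤ ‖f w‖ * (ε⁻¹ * ‖w - z‖) := by
          gcongr
          exact norm_regularizer_le_norm_sub hf.im_nonpos hε hw.1
      _ = _ := by ring
  · have hU : z ∈ U := hf.subset ⟨hz, hne⟩
    exact ((hf.differentiableOn.differentiableAt (hf.isOpen.mem_nhds hU)).continuousAt.mul
      (differentiableAt_regularizer hf.im_nonpos hε hz).continuousAt).continuousWithinAt

lemma IsGenerator.differentiableOn_mul_regularizer (hf : IsGenerator α U f) (hε : 0 < ε) :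
    DifferentiableOn ℂ (fun z => f z * regularizer α ε z) {z | 0 < z.im} := fun _ hz =>
  ((hf.differentiableOn.differentiableAt (hf.isOpen.mem_nhds (hf.mem hz))).mul
    (differentiableAt_regularizer hf.im_nonpos hε hz.le)).differentiableWithinAt

lemma IsGenerator.tendsto_mul_regularizer (hf : IsGenerator α U f) (hsub : SublinearAtInfinity α f)
    (hε : 0 < ε) :
    Tendsto (fun z => f z * regularizer α ε z) (Bornology.cobounded ℂ ⊓ 𝓟 {z | 0 ≤ z.im})
      (𝓝 0) := by
  have hb := hsub.tendsto.const_mul ε⁻¹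
  rw [mul_zero] at hb
  refine squeeze_zero_norm' ?_ hb
  have hne : ∀ᶠ z in Bornology.cobounded ℂ, z ≠ 0 :=
    (tendsto_norm_cobounded_atTop.eventually_gt_atTop 0).mono fun z hz h => by simp [h] at hz
  filter_upwards [hne.filter_mono inf_le_left, (eventually_principal.2 fun z hz => hz :
    ∀ᶠ z in 𝓟 {z : ℂ | 0 ≤ z.im}, z ∈ {z : ℂ | 0 ≤ z.im}).filter_mono inf_le_right] with z hz hz'
  rw [norm_mul]
  calc ‖f z‖ * ‖regularizer α ε z‖ ≤ ‖f z‖ * (ε⁻¹ * ‖z‖⁻¹) := by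
        gcongr
        exact norm_regularizer_le_inv hf.im_nonpos hε hz' hz
    _ = _ := by ring

lemma ae_ne_cauchyMeasure (μ : ℝ) {σ : ℝ≥0} (hσ : 0 < σ) (α : ℂ) :
    ∀ᵐ x : ℝ ∂(cauchyMeasure μ σ), (x : ℂ) ≠ α := by
  rw [cauchyMeasure_of_scale_ne_zero μ hσ.ne']
  refine (withDensity_absolutelyContinuous _ _).ae_le ?_
  have hs : {x : ℝ | (x : ℂ) = α}.Subsingleton := fun x hx y hy =>
    Complex.ofReal_injective (hx.trans hy.symm)
  have := hs.measure_zero volume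
  change volume {x : ℝ | ¬ (x : ℂ) ≠ α} = 0
  simpa using this

/-- The mean value formula for powers of `f` under the Cauchy distribution. -/
theorem IsGenerator.integral_pow_cauchyMeasure (hf : IsGenerator α U f)
    (hsub : SublinearAtInfinity α f) (hsing : MildSingularity α f) (μ : ℝ) {σ : ℝ≥0} (hσ : 0 < σ)
    {p : ℕ} (hp : p ≠ 0) (hint : Integrable (fun x : ℝ => f x ^ p) (cauchyMeasure μ σ)) :
    ∫ x : ℝ, f x ^ p ∂(cauchyMeasure μ σ) = f (μ + σ * Complex.I) ^ p := by
  have hσ' : (0 : ℝ) < σ := hσ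
  -- The regularizer is raised to the power `p` along with `f`, because `f ^ p` may grow like
  -- `o(|z|^p)`.
  have hcont : ∀ ε : ℝ, 0 < ε →
      ContinuousOn (fun z => (f z * regularizer α ε z) ^ p) {z | 0 ≤ z.im} := fun ε hε =>
    (hf.continuousOn_mul_regularizer hsing hε).pow p
  have hpos : ∀ᶠ ε : ℝ in 𝓝[>] 0, 0 < ε := self_mem_nhdsWithin
  have heq : ∀ᶠ ε : ℝ in 𝓝[>] 0, ∫ x : ℝ, (f x * regularizer α ε x) ^ p ∂(cauchyMeasure μ σ) =
      (f (μ + σ * Complex.I) * regularizer α ε (μ + σ * Complex.I)) ^ p := by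
    filter_upwards [hpos] with ε hε
    refine integral_cauchyMeasure_eq μ hσ (hcont ε hε)
      ((hf.differentiableOn_mul_regularizer hε).pow p) ?_
    have := (hf.tendsto_mul_regularizer hsub hε).pow p
    rwa [zero_pow hp] at this
  have hlim : Tendsto
      (fun ε : ℝ => ∫ x : ℝ, (f x * regularizer α ε x) ^ p ∂(cauchyMeasure μ σ)) (𝓝[>] 0)
      (𝓝 (∫ x : ℝ, f x ^ p ∂(cauchyMeasure μ σ))) := by
    refine tendsto_integral_filter_of_dominated_convergence (fun x => ‖f x ^ p‖) ?_ ?_ hint.norm ?_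
    · filter_upwards [hpos] with ε hε
      exact Continuous.aestronglyMeasurable
        ((hcont ε hε).comp_continuous Complex.continuous_ofReal fun x => by simp)
    · filter_upwards [hpos] with ε hε
      refine ae_of_all _ fun x => ?_
      rw [mul_pow, norm_mul, norm_pow (regularizer _ _ _)]
      refine mul_le_of_le_one_right (norm_nonneg _) (pow_le_one₀ (norm_nonneg _)
        (norm_regularizer_le_one hf.im_nonpos hε (by simp)))
    · filter_upwards [ae_ne_cauchyMeasure μ hσ α] with x hx
      simpa using ((tendsto_regularizer hx).const_mul (f x)).pow p
  have hγ : (μ + σ * Complex.I : ℂ) ≠ α := fun h => by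
    have h1 := hf.im_nonpos
    rw [← h] at h1
    simp at h1
    exact absurd hσ (not_lt.2 (by exact_mod_cast h1))
  have hlim' : Tendsto
      (fun ε : ℝ => (f (μ + σ * Complex.I) * regularizer α ε (μ + σ * Complex.I)) ^ p) (𝓝[>] 0)
      (𝓝 (f (μ + σ * Complex.I) ^ p)) := by
    simpa using ((tendsto_regularizer hγ).const_mul (f (μ + σ * Complex.I))).pow p
  exact tendsto_nhds_unique (hlim.congr' heq) hlim'

end Regularization

/-! ### The central limit theorem for isotropic complex variables. -/

section CentralLimit

variable {Ω : Type*} [MeasurableSpace Ω] {P : Measure Ω}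

lemma continuous_toR2 : Continuous toR2 := by
  unfold toR2
  refine (PiLp.continuous_toLp 2 _).comp (continuous_pi fun i => ?_)
  fin_cases i
  · exact Complex.continuous_re
  · exact Complex.continuous_im

/-- Real functionals of the plane become real parts of complex multiples, which lets isotropy be
expressed through complex squares. -/
lemma inner_toR2 (z : ℂ) (t : EuclideanSpace ℝ (Fin 2)) :
    inner ℝ (toR2 z) t = ((t 0 - t 1 * Complex.I) * z).re := by
  simp [toR2, PiLp.inner_apply, Fin.sum_univ_two]

/-- Separates a rotation-invariant part from a part whose expectation vanishes under isotropy. -/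
lemma re_sq_eq (w : ℂ) : w.re ^ 2 = (‖w‖ ^ 2 + (w ^ 2).re) / 2 := by
  rw [← Complex.normSq_eq_norm_sq, Complex.normSq_apply, sq w, Complex.mul_re]
  ring

/-- The variance of a real linear functional of an isotropic complex random variable. -/
lemma variance_re_mul [IsProbabilityMeasure P] {Y : Ω → ℂ} (hL : MemLp Y 2 P)
    (hiso : ∫ ω, (Y ω - ∫ ω', Y ω' ∂P) ^ 2 ∂P = 0) (a : ℂ) :
    Var[fun ω => (a * Y ω).re; P] = ‖a‖ ^ 2 * (complexVar Y P / 2) := by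
  set m := ∫ ω', Y ω' ∂P with hm
  have hint : Integrable Y P := hL.integrable (by norm_num)
  have hmean : ∫ ω, (a * Y ω).re ∂P = (a * m).re := by
    have := integral_re (hint.const_mul a)
    simp only [RCLike.re_to_complex] at this
    rw [this, integral_const_mul]
  have hL' : MemLp (fun ω => Y ω - m) 2 P := hL.sub (memLp_const m)
  have hsq : Integrable (fun ω => ‖Y ω - m‖ ^ 2) P := hL'.integrable_norm_pow (by norm_num)
  have hsq' : Integrable (fun ω => (Y ω - m) ^ 2) P := by
    refine hsq.mono' (hL'.aestronglyMeasurable.pow 2) (ae_of_all _ fun ω => ?_)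
    rw [norm_pow]
  have hre : ∫ ω, (a ^ 2 * (Y ω - m) ^ 2).re ∂P = 0 := by
    have := integral_re (hsq'.const_mul (a ^ 2))
    simp only [RCLike.re_to_complex] at this
    rw [this, integral_const_mul, hiso, mul_zero, Complex.zero_re]
  have hre_int : Integrable (fun ω => (a ^ 2 * (Y ω - m) ^ 2).re) P := (hsq'.const_mul (a ^ 2)).re
  have haem : AEMeasurable (fun ω => (a * Y ω).re) P :=
    Complex.measurable_re.comp_aemeasurable (hint.aemeasurable.const_mul a)
  rw [variance_eq_integral haem, hmean]
  have hpt : ∀ ω, ((a * Y ω).re - (a * m).re) ^ 2 =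
      (‖a‖ ^ 2 * ‖Y ω - m‖ ^ 2 + (a ^ 2 * (Y ω - m) ^ 2).re) / 2 := fun ω => by
    rw [← Complex.sub_re, ← mul_sub, re_sq_eq, norm_mul, mul_pow, mul_pow]
  simp_rw [hpt]
  rw [integral_div, integral_add (hsq.const_mul _) hre_int, hre, integral_const_mul, complexVar]
  ring

lemma sqrt_mul_average_sub (n : ℕ) (s m : ℂ) :
    ((√(n : ℝ) : ℝ) : ℂ) * ((1 / (n : ℂ)) * s - m) = ((√(n : ℝ))⁻¹ : ℝ) * (s - n * m) := by
  rcases Nat.eq_zero_or_pos n with rfl | hn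
  · simp
  · have h : (√(n : ℝ) : ℂ) * √(n : ℝ) = n := by
      exact_mod_cast Real.mul_self_sqrt (Nat.cast_nonneg n)
    have h0 : (√(n : ℝ) : ℂ) ≠ 0 := by
      have : √(n : ℝ) ≠ 0 := by positivity
      exact_mod_cast this
    rw [← h]
    push_cast
    field_simp

/-- The central limit theorem for isotropic complex random variables. -/
theorem tendstoInDistribution_toR2_average [IsProbabilityMeasure P] {Y : ℕ → Ω → ℂ}
    (hindep : iIndepFun Y P) (hident : ∀ i, IdentDistrib (Y i) (Y 0) P P) (hL : MemLp (Y 0) 2 P)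
    (hiso : ∫ ω, (Y 0 ω - ∫ ω', Y 0 ω' ∂P) ^ 2 ∂P = 0) :
    TendstoInDistribution
      (fun (n : ℕ) ω => toR2 (((√(n : ℝ) : ℝ) : ℂ) *
        ((1 / (n : ℂ)) * ∑ j ∈ Finset.range n, Y j ω - ∫ ω', Y 0 ω' ∂P)))
      atTop id (fun _ => P)
      (multivariateGaussian 0 ((complexVar (Y 0) P / 2) • (1 : Matrix (Fin 2) (Fin 2) ℝ))) := by
  set m := ∫ ω', Y 0 ω' ∂P with hm
  have hint : Integrable (Y 0) P := hL.integrable (by norm_num)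
  have hmeas : ∀ i, AEMeasurable (Y i) P := fun i => (hident i).aemeasurable_fst
  have hV : 0 ≤ complexVar (Y 0) P := integral_nonneg fun ω => by positivity
  have hVmeas : ∀ n : ℕ, AEMeasurable (fun ω => toR2 (((√(n : ℝ) : ℝ) : ℂ) *
        ((1 / (n : ℂ)) * ∑ j ∈ Finset.range n, Y j ω - m))) P := fun n =>
    continuous_toR2.measurable.comp_aemeasurable
      (((Finset.aemeasurable_fun_sum _ fun i _ => hmeas i).const_mul _).sub_const _ |>.const_mul _)
  refine ⟨hVmeas, aemeasurable_id, ProbabilityMeasure.tendsto_iff_tendsto_charFun.2 fun t => ?_⟩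
  -- Cramér–Wold: the characteristic function at `t` is that of the real projection `W` at 1, to
  -- which the one-dimensional theorem applies.
  set a : ℂ := t 0 - t 1 * Complex.I with ha
  have hg : Measurable (fun z : ℂ => (a * z).re) := by fun_prop
  set W : ℕ → Ω → ℝ := fun i ω => (a * Y i ω).re with hW
  have hWmean : ∫ ω, W 0 ω ∂P = (a * m).re := by
    have := integral_re (hint.const_mul a)
    simp only [RCLike.re_to_complex] at this
    rw [hW, this, integral_const_mul]
  have hWvar : Var[W 0; P] = ‖a‖ ^ 2 * (complexVar (Y 0) P / 2) := variance_re_mul hL hiso a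
  have hclt := tendstoInDistribution_inv_sqrt_mul_sum_sub (X := W) (P := P)
    (P' := gaussianReal 0 Var[W 0; P].toNNReal) (Y := id) HasLaw.id
    ((hL.const_mul a).re) (hindep.comp (fun _ z => (a * z).re) fun _ => hg)
    (fun i => (hident i).comp hg)
  have hchar := ProbabilityMeasure.tendsto_iff_tendsto_charFun.1 hclt.tendsto 1
  have hna : ‖a‖ ^ 2 = t 0 ^ 2 + t 1 ^ 2 := by
    rw [← Complex.normSq_eq_norm_sq, Complex.normSq_apply, ha]
    simp
    ring
  have hS : ((complexVar (Y 0) P / 2) • (1 : Matrix (Fin 2) (Fin 2) ℝ)).PosSemidef :=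
    Matrix.PosSemidef.one.smul (by positivity)
  -- By isotropy the variance of the projection depends on `t` only through `|t|²`, as for a
  -- Gaussian with scalar covariance.
  have hlimit : charFun (gaussianReal 0 Var[W 0; P].toNNReal) 1 =
      charFun (multivariateGaussian 0
        ((complexVar (Y 0) P / 2) • (1 : Matrix (Fin 2) (Fin 2) ℝ))) t := by
    rw [charFun_gaussianReal, charFun_multivariateGaussian hS,
      Real.coe_toNNReal _ (variance_nonneg _ _), hWvar, hna]
    congr 1
    simp [Matrix.smul_mulVec, dotProduct, Fin.sum_univ_two]
    ring
  simp only [Measure.map_id, ProbabilityMeasure.coe_mk] at hchar ⊢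
  rw [← hlimit]
  refine hchar.congr fun n => ?_
  have hWn : AEMeasurable
      (fun ω => (√(n : ℝ))⁻¹ * (∑ k ∈ Finset.range n, W k ω - n * ∫ ω, W 0 ω ∂P)) P :=
    hclt.forall_aemeasurable n
  rw [charFun_apply, charFun_apply, integral_map hWn (by fun_prop),
    integral_map (hVmeas n) (by fun_prop)]
  congr 1
  ext ω
  rw [inner_toR2, sqrt_mul_average_sub, hWmean]
  congr 3
  simp only [Real.inner_apply, mul_one, hW]
  have hlin : (a * (∑ j ∈ Finset.range n, Y j ω - n * m)).re =
      ∑ j ∈ Finset.range n, (a * Y j ω).re - n * (a * m).re := by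
    rw [mul_sub, Complex.sub_re, Finset.mul_sum, Complex.re_sum, mul_left_comm,
      ← Complex.ofReal_natCast, Complex.re_ofReal_mul]
  rw [mul_left_comm, Complex.re_ofReal_mul, ← ha, hlin]

end CentralLimit

/-! ### Measurability and the delta method. -/

section Mean

variable {Ω : Type*} [MeasurableSpace Ω] {P : Measure Ω} {α : ℂ} {U : Set ℂ} {f : ℂ → ℂ}

lemma IsGenerator.measurable_comp_ofReal (hf : IsGenerator α U f) :
    Measurable (fun x : ℝ => f x) := by
  have hopen : IsOpen {x : ℝ | (x : ℂ) ≠ α} := isOpen_ne.preimage Complex.continuous_ofReal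
  refine measurable_of_restrict_of_restrict_compl hopen.measurableSet ?_ ?_
  · refine Continuous.measurable (continuousOn_iff_continuous_domRestrict.1 ?_)
    exact (hf.differentiableOn.continuousOn.mono hf.subset).comp
      Complex.continuous_ofReal.continuousOn fun x hx => ⟨by simp, hx⟩
  · have : Subsingleton ↑({x : ℝ | (x : ℂ) ≠ α}ᶜ) := by
      refine Set.subsingleton_coe _ |>.2 fun x hx y hy => ?_
      simp only [Set.mem_compl_iff, Set.mem_ofPred_eq, not_not] at hx hy
      exact Complex.ofReal_injective (hx.trans hy.symm)
    exact measurable_of_countable _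

lemma complexVar_const_mul (c : ℂ) (Y : Ω → ℂ) :
    complexVar (fun ω => c * Y ω) P = ‖c‖ ^ 2 * complexVar Y P := by
  simp only [complexVar]
  rw [integral_const_mul, ← integral_const_mul (‖c‖ ^ 2)]
  refine integral_congr_ae (ae_of_all _ fun ω => ?_)
  simp only [← mul_sub, norm_mul, mul_pow]

/-- The identification of `ℝ²` with `ℂ`. -/
noncomputable def ofR2 (x : EuclideanSpace ℝ (Fin 2)) : ℂ := x 0 + x 1 * Complex.I

lemma continuous_ofR2 : Continuous ofR2 := by
  unfold ofR2
  fun_prop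

lemma ofR2_toR2 (z : ℂ) : ofR2 (toR2 z) = z := by
  simp [ofR2, toR2]

lemma toR2_ofR2 (x : EuclideanSpace ℝ (Fin 2)) : toR2 (ofR2 x) = x := by
  ext i
  fin_cases i <;> simp [ofR2, toR2]

/-- The **delta method** for a complex differentiable function. -/
theorem tendstoInDistribution_toR2_of_hasDerivAt [IsProbabilityMeasure P] {S : ℕ → Ω → ℂ}
    {r : ℕ → ℂ} {m c : ℂ} {g : ℂ → ℂ} (hg : HasDerivAt g c m) (hc : c ≠ 0) (hgm : Measurable g)
    (hS : ∀ n, AEMeasurable (S n) P) (hSm : ∀ᵐ ω ∂P, Tendsto (fun n => S n ω) atTop (𝓝 m))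
    {ν : Measure (EuclideanSpace ℝ (Fin 2))} [IsProbabilityMeasure ν]
    (hclt : TendstoInDistribution (fun n ω => toR2 (r n * (c * S n ω - c * m))) atTop id
      (fun _ => P) ν) :
    TendstoInDistribution (fun n ω => toR2 (r n * (g (S n ω) - g m))) atTop id (fun _ => P) ν := by
  classical
  -- The difference quotient of `g` divided by its limit `c`. With the value 1 at `m` it is
  -- continuous there, and `hq_mul` is an exact identity, with no remainder term.
  set q : ℂ → ℂ := Function.update (fun s => c⁻¹ * ((s - m)⁻¹ * (g s - g m))) m 1 with hq
  have hqm : Measurable q := by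
    have : q = fun s => if s = m then 1 else c⁻¹ * ((s - m)⁻¹ * (g s - g m)) :=
      funext fun s => Function.update_apply _ _ _ _
    rw [this]
    exact Measurable.ite (measurableSet_singleton m) measurable_const (by fun_prop)
  have hq_tendsto : ContinuousAt q m := by
    rw [hq, continuousAt_update_same]
    have := (hasDerivAt_iff_tendsto_slope.1 hg).const_mul c⁻¹
    rw [inv_mul_cancel₀ hc] at this
    exact this.congr fun s => by rw [slope_def_field, div_eq_inv_mul]
  have hq_mul : ∀ s, g s - g m = q s * (c * s - c * m) := fun s => by
    rcases eq_or_ne s m with rfl | hs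
    · simp
    · rw [hq, Function.update_of_ne hs]
      have := sub_ne_zero.2 hs
      rw [← mul_sub]
      field_simp
  have hqS : ∀ n, AEMeasurable (fun ω => q (S n ω)) P := fun n => hqm.comp_aemeasurable (hS n)
  have hqS_tendsto : TendstoInMeasure P (fun n ω => q (S n ω)) atTop (fun _ => (1 : ℂ)) := by
    refine tendstoInMeasure_of_tendsto_ae (fun n => (hqS n).aestronglyMeasurable) ?_
    filter_upwards [hSm] with ω hω
    have h := hq_tendsto.tendsto.comp hω
    rwa [show q m = 1 by simp [hq]] at h
  -- Slutsky's theorem for the product: the factor `q (S n)` tends to 1 in measure, so the limit law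
  -- `ν` is unchanged.
  have h := hclt.continuous_comp_prodMk_of_tendstoInMeasure_const
    (g := fun p : EuclideanSpace ℝ (Fin 2) × ℂ => toR2 (p.2 * ofR2 p.1))
    (continuous_toR2.comp (continuous_snd.mul (continuous_ofR2.comp continuous_fst)))
    hqS_tendsto hqS
  refine h.congr (fun n => ae_of_all _ fun ω => ?_) (ae_of_all _ fun x => ?_)
  · simp only [ofR2_toR2, hq_mul]
    rw [mul_left_comm]
  · simp only [one_mul, id, toR2_ofR2]

end Mean

end QAM

/-! ### Limit theorems for the `f`-mean. -/

theorem proposition4p1 {Ω : Type*} [MeasurableSpace Ω] (P : Measure Ω) [IsProbabilityMeasure P]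
    (μ : ℝ) (σ : ℝ≥0) (hσ : 0 < σ)
    (X : ℕ → Ω → ℝ) (hindep : iIndepFun X P) (hlaw : ∀ i, HasLaw (X i) (cauchyMeasure μ σ) P)
    (α : ℂ) (U : Set ℂ) (f : ℂ → ℂ) (hf : QAM.IsGenerator α U f)
    (hint : Integrable (fun ω => f (X 0 ω)) P)
    (hsub : QAM.SublinearAtInfinity α f)
    (hsing : QAM.MildSingularity α f) :
    (∫ ω, f (X 0 ω) ∂P = f (μ + σ * Complex.I)) ∧
    (∀ᵐ ω ∂P, Tendsto (fun n : ℕ => QAM.fMean U f (fun j => (X j ω : ℂ)) n) atTop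
      (𝓝 (μ + σ * Complex.I))) ∧
    (Integrable (fun ω => ‖f (X 0 ω)‖ ^ 2) P →
      TendstoInDistribution
        (fun (n : ℕ) ω => QAM.toR2 (((√(n : ℝ) : ℝ) : ℂ) *
          (QAM.fMean U f (fun j => (X j ω : ℂ)) n - (μ + σ * Complex.I))))
        atTop id (fun _ => P)
        (multivariateGaussian 0
          ((QAM.complexVar (fun ω => f (X 0 ω)) P /
              (2 * ‖deriv f (μ + σ * Complex.I)‖ ^ 2)) • (1 : Matrix (Fin 2) (Fin 2) ℝ)))) := by
  set γ : ℂ := μ + σ * Complex.I with hγ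
  have hγU : γ ∈ U := hf.mem (by simpa [hγ] using hσ)
  have hfm : Measurable (fun x : ℝ => f x) := hf.measurable_comp_ofReal
  have hmoment : ∀ p : ℕ, p ≠ 0 → Integrable (fun ω => f (X 0 ω) ^ p) P →
      ∫ ω, f (X 0 ω) ^ p ∂P = f γ ^ p := by
    intro p hp hi
    have hmeas : AEStronglyMeasurable (fun x : ℝ => f x ^ p) (P.map (X 0)) :=
      (hfm.pow_const p).aestronglyMeasurable
    rw [← hf.integral_pow_cauchyMeasure hsub hsing μ hσ hp, ← (hlaw 0).map_eq,
      integral_map (hlaw 0).aemeasurable hmeas]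
    rw [← (hlaw 0).map_eq, integrable_map_measure hmeas (hlaw 0).aemeasurable]
    exact hi
  have hmean : ∫ ω, f (X 0 ω) ∂P = f γ := by
    simpa using hmoment 1 one_ne_zero (by simpa using hint)
  set Y : ℕ → Ω → ℂ := fun j ω => f (X j ω) with hY
  have hYindep : iIndepFun Y P := hindep.comp (fun _ x => f x) fun _ => hfm
  have hYident : ∀ i, IdentDistrib (Y i) (Y 0) P P := fun i =>
    IdentDistrib.comp (f := X i) (g := X 0) ⟨(hlaw i).aemeasurable, (hlaw 0).aemeasurable,
      (hlaw i).map_eq.trans (hlaw 0).map_eq.symm⟩ hfm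
  have hslln : ∀ᵐ ω ∂P, Tendsto
      (fun n : ℕ => (1 / (n : ℂ)) * ∑ j ∈ Finset.range n, Y j ω) atTop (𝓝 (f γ)) := by
    filter_upwards [strong_law_ae Y hint (fun i j hij => hYindep.indepFun hij) hYident] with ω hω
    rw [show ∫ ω, Y 0 ω ∂P = f γ from hmean] at hω
    refine hω.congr fun n => ?_
    rw [Complex.real_smul]
    push_cast
    rw [one_div]
  have hinv : HasDerivAt (Function.invFunOn f U) (deriv f γ)⁻¹ (f γ) :=
    QAM.hasDerivAt_invFunOn hf.isOpen hf.differentiableOn hf.injOn hγU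
  have hinvγ : Function.invFunOn f U (f γ) = γ := QAM.invFunOn_apply_of_injOn hf.injOn hγU
  refine ⟨hmean, ?_, fun hsq => ?_⟩
  · filter_upwards [hslln] with ω hω
    have := hinv.continuousAt.tendsto.comp hω
    rwa [hinvγ] at this
  set c : ℂ := (deriv f γ)⁻¹ with hc
  have hc0 : c ≠ 0 :=
    inv_ne_zero (QAM.deriv_ne_zero_of_injOn hf.isOpen hf.differentiableOn hf.injOn hγU)
  have hL : MemLp (Y 0) 2 P :=
    (memLp_two_iff_integrable_sq_norm hint.aestronglyMeasurable).2 hsq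
  have hint2 : Integrable (fun ω => f (X 0 ω) ^ 2) P :=
    hsq.mono' (hint.aestronglyMeasurable.pow 2) (ae_of_all _ fun ω => by rw [norm_pow])
  -- The integral equals `c²` times E[f(X)²] - f(γ)², which vanishes by the moment formula with
  -- exponent 2.
  have hiso : ∫ ω, (c * Y 0 ω - ∫ ω', c * Y 0 ω' ∂P) ^ 2 ∂P = 0 := by
    have hpt : ∀ ω, (c * Y 0 ω - c * f γ) ^ 2 =
        c ^ 2 * (f (X 0 ω) ^ 2 - 2 * f γ * f (X 0 ω) + f γ ^ 2) := fun ω => by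
      rw [hY]
      ring
    rw [integral_const_mul, show ∫ ω, Y 0 ω ∂P = f γ from hmean]
    simp_rw [hpt]
    have hlin : Integrable (fun ω => f (X 0 ω) ^ 2 - 2 * f γ * f (X 0 ω)) P :=
      hint2.sub (hint.const_mul _)
    rw [integral_const_mul, integral_add hlin (integrable_const _), integral_sub hint2 (hint.const_mul _), integral_const_mul, hmean,
      hmoment 2 two_ne_zero hint2]
    simp
    right
    ring
  -- Scaling by `c` before the central limit theorem gives the final covariance at once: the
  -- variance picks up `‖c‖² = 1 / ‖f' γ‖²`.
  have hclt := QAM.tendstoInDistribution_toR2_average (Y := fun j ω => c * Y j ω)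
    (hYindep.comp (fun _ z => c * z) fun _ => measurable_const_mul c)
    (fun i => (hYident i).comp (measurable_const_mul c)) (hL.const_mul c) hiso
  have hvar : QAM.complexVar (fun ω => c * Y 0 ω) P / 2 =
      QAM.complexVar (fun ω => f (X 0 ω)) P / (2 * ‖deriv f γ‖ ^ 2) := by
    rw [QAM.complexVar_const_mul, hc, norm_inv]
    ring
  rw [hvar] at hclt
  have hdelta := QAM.tendstoInDistribution_toR2_of_hasDerivAt
    (S := fun (n : ℕ) ω => (1 / (n : ℂ)) * ∑ j ∈ Finset.range n, Y j ω)
    (r := fun n : ℕ => ((√(n : ℝ) : ℝ) : ℂ)) hinv hc0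
    (QAM.measurable_invFunOn hf.isOpen hf.differentiableOn hf.injOn)
    (fun n => (Finset.aemeasurable_fun_sum _
      fun i _ => (hYident i).aemeasurable_fst).const_mul _) hslln
    (hclt.congr (fun n => ae_of_all _ fun ω => by
      rw [integral_const_mul, show ∫ ω, Y 0 ω ∂P = f γ from hmean, ← Finset.mul_sum,
        mul_left_comm]) (ae_of_all _ fun _ => rfl))
  rw [hinvγ] at hdelta
  exact hdelta
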